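/- For $n\ge 1$ and integers $j,k$ let $P_n(j,k)$ be the number of permutations $\sigma$ of $\{1,\dots,n\}$ that avoid the pattern $123$ (there are no $i_1<i_2<i_3$ with $\sigma(i_1)<\sigma(i_2)<\sigma(i_3)$) and satisfy $\sigma(j)=k$, and let $C_n=\frac1{n+1}\binom{2n}{n}$. Fix real numbers $0<a<1$, $c\in\mathbb R$ and $0\le\alpha\le\frac12$, and put $$x_n=\begin{cases}an-cn^{\alpha}+1&\text{if }c=0\text{ or }\alpha=0,\\ an-cn^{\alpha}&\text{otherwise,}\end{cases}\qquad y_n=(1-a)n-cn^{\alpha}.$$ Let $(j_n,k_n)$ be any integer rounding of $(x_n,y_n)$, i.e. any integer sequences such that $j_n-x_n$ and $k_n-y_n$ are bounded. Let $$F=\sup\Big\{d\ge 0:\ \lim_{n\to\infty}\frac{n^dP_n(j_n,k_n)}{C_n}\text{ exists and is finite}\Big\},\qquad L(a,1-a,c,\alpha)=\lim_{n\to\infty}\frac{n^{F}P_n(j_n,k_n)}{C_n}.$$ Write $$\xi(a,c)=\frac{(2c+1)^2}{4\sqrt\pi\,(a(1-a))^{3/2}},\qquad \eta(a,c)=\frac{c^2}{\sqrt\pi\,(a(1-a))^{3/2}},\qquad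 \kappa(a,c)=\exp\Big[\frac{-c^2}{a(1-a)}\Big].$$ Then in all cases $F<\infty$, and: 1. Suppose $c=0$ or $\alpha=0$. If the rounding keeps the distance to the anti-diagonal, i.e. $j_n+k_n=x_n+y_n=n+1-2c$ for all large $n$ (for $\alpha=0$ this requires $2c\in\mathbb Z$), then the limit $L(a,1-a,c,\alpha)$ exists and equals $\xi(a,|c|)$. For an arbitrary rounding (and every real $c$), $\frac{n^{F}P_n(j_n,k_n)}{C_n}-\xi(a,c_n)\to 0$, where $c_n=\frac12|n+1-j_n-k_n|$. 2. If $c\ne0$ and $0<\alpha<\frac12$, then the limit $L(a,1-a,c,\alpha)$ exists and equals $\eta(a,c)$. 3. If $c\ne0$ and $\alpha=\frac12$, then the limit $L(a,1-a,c,\alpha)$ exists and equals $\eta(a,c)\,\kappa(a,c)$. -/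

import Mathlib

open Filter Topology
open scoped NNReal ENNReal

namespace PatternShape

/-- The permutation `σ` of `{1, …, n}` contains the pattern `τ`: there are positions
`i₁ < ⋯ < iₘ` at which the values of `σ` are in the same relative order as `τ`. -/
def Contains {m n : ℕ} (σ : Equiv.Perm (Fin n)) (τ : Equiv.Perm (Fin m)) : Prop :=
  ∃ i : Fin m → Fin n, StrictMono i ∧ ∀ s t : Fin m, σ (i s) < σ (i t) ↔ τ s < τ t

/-- `σ` avoids the pattern `123`, i.e. the identity permutation of three letters. -/
def Avoids123 {n : ℕ} (σ : Equiv.Perm (Fin n)) : Prop :=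
  ¬ Contains σ (1 : Equiv.Perm (Fin 3))

/-- `P n j k` is the number of `123`-avoiding permutations `σ` of `{1, …, n}` with `σ(j) = k`.
Positions and values are counted from `1`, so `p : Fin n` stands for `p + 1`; the number is `0`
if `j` or `k` is not in `{1, …, n}`. -/
noncomputable def P (n : ℕ) (j k : ℤ) : ℕ :=
  Nat.card {σ : Equiv.Perm (Fin n) //
    Avoids123 σ ∧ ∃ p : Fin n, ((p : ℕ) : ℤ) + 1 = j ∧ ((σ p : ℕ) : ℤ) + 1 = k}

open Classical in
/-- The real first index `an - cn^α`, shifted by `+1` on the anti-diagonal `a + b = 1` if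
`α = 0` or `c = 0`. -/
noncomputable def firstIndex (a b c α : ℝ) (n : ℕ) : ℝ :=
  a * n - c * (n : ℝ) ^ α + (if a + b = 1 ∧ (α = 0 ∨ c = 0) then 1 else 0)

/-- The real second index `bn - cn^α`. -/
noncomputable def secondIndex (b c α : ℝ) (n : ℕ) : ℝ :=
  b * n - c * (n : ℝ) ^ α

/-- The integer sequences `j`, `k` are a rounding of the two real indices: they stay within a
bounded distance of them (as for integer parts, nearest integers, or rounding term by term). -/
def IsRounding (a b c α : ℝ) (j k : ℕ → ℤ) : Prop :=
  ∃ K : ℝ, ∀ n : ℕ,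
    |(j n : ℝ) - firstIndex a b c α n| ≤ K ∧ |(k n : ℝ) - secondIndex b c α n| ≤ K

/-- The rounding stays, for large `n`, at the exact distance of the real indices from the
anti-diagonal: the sum of the indices is not changed. -/
def KeepsDistance (a b c α : ℝ) (j k : ℕ → ℤ) : Prop :=
  ∀ᶠ n : ℕ in atTop, (j n : ℝ) + (k n : ℝ) = firstIndex a b c α n + secondIndex b c α n

/-- The sequence `n^d P_n(j_n, k_n) / C_n`. -/
noncomputable def scaled (j k : ℕ → ℤ) (d : ℝ) (n : ℕ) : ℝ :=
  (n : ℝ) ^ d * (P n (j n) (k n) : ℝ) / (catalan n : ℝ)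

/-- The exponent `F`: the supremum (possibly `∞`) of all `d ≥ 0` such that
`n^d P_n(j_n, k_n) / C_n` has a finite limit. -/
noncomputable def F (j k : ℕ → ℤ) : ℝ≥0∞ :=
  ⨆ (d : ℝ≥0) (_ : ∃ l : ℝ, Tendsto (scaled j k (d : ℝ)) atTop (𝓝 l)), (d : ℝ≥0∞)

/-- The constant `L` is defined and equals `l`: the exponent `F` is finite and
`n^F P_n(j_n, k_n) / C_n` converges to `l`. -/
def HasL (j k : ℕ → ℤ) (l : ℝ) : Prop :=
  F j k ≠ ⊤ ∧ Tendsto (scaled j k (F j k).toReal) atTop (𝓝 l)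

noncomputable def xi (a c : ℝ) : ℝ :=
  (2 * c + 1) ^ 2 / (4 * √Real.pi * (a * (1 - a)) ^ (3 / 2 : ℝ))

noncomputable def eta (a c : ℝ) : ℝ :=
  c ^ 2 / (√Real.pi * (a * (1 - a)) ^ (3 / 2 : ℝ))

noncomputable def kappa (a c : ℝ) : ℝ :=
  Real.exp (-c ^ 2 / (a * (1 - a)))

end PatternShape

/-! There is an exact product formula. Let `p`, `s` be the numbers of positions before and after
`j`, and `r`, `q` the numbers of values below and above `k`. Then `P` is a product of two ballot
numbers, equal to `(|q - p| + 1)² C(p+q, p) C(r+s, r) / ((max p q + 1)(max r s + 1))` (`P_mul`). It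
comes from building a permutation by prepending first values: `123`-avoidance is preserved exactly
when the values above the new entry already decrease. Tracking the threshold `t` above which values
decrease gives the ballot recurrence (`cardDec_eq`, `cardDecAt_eq`). Reverse-complement settles the
other side of the anti-diagonal.

Put `δ = n + 1 - j - k = q - p`. Here `p + q ~ 2an` and `r + s ~ 2(1-a)n`, so if `δ²/n → μ`, the
local limit theorem (`tendsto_choose`) gives the two binomials Gaussian factors `exp(-μ/(4a))` and
`exp(-μ/(4(1-a)))`. Dividing by the asymptotics of `C_n` yields `n^(3/2) P_n / (C_n (|δ|+1)²) →
profile a μ` (`tendsto_profile`).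

A rounding has `δ = 2c n^α + O(1)`. If `δ` is bounded, then `μ = 0`, `F = 3/2` and `(|δ|+1)²` stays
in the constant, giving `ξ`. Otherwise `(|δ|+1)² ~ 4c² n^(2α)` and `F = 3/2 - 2α`, with `μ = 0` for
`α < 1/2` (giving `η`) and `μ = 4c²` for `α = 1/2` (giving the extra factor `κ`). -/

namespace PatternShape

/-! ### Prepending a first value and `123`-avoidance -/

/-- The permutation with first value `l` whose other values are order isomorphic to `τ`. -/
def consPerm {n : ℕ} (l : Fin (n + 1)) (τ : Equiv.Perm (Fin n)) : Equiv.Perm (Fin (n + 1)) :=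
  (finSuccEquiv n).trans ((Equiv.optionCongr τ).trans (finSuccEquiv' l).symm)

@[simp] lemma consPerm_zero {n : ℕ} (l : Fin (n + 1)) (τ : Equiv.Perm (Fin n)) :
    consPerm l τ 0 = l := by
  simp [consPerm]

@[simp] lemma consPerm_succ {n : ℕ} (l : Fin (n + 1)) (τ : Equiv.Perm (Fin n)) (i : Fin n) :
    consPerm l τ i.succ = l.succAbove (τ i) := by
  simp [consPerm]

lemma consPerm_bijective (n : ℕ) :
    Function.Bijective fun x : Fin (n + 1) × Equiv.Perm (Fin n) => consPerm x.1 x.2 := by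
  rw [Fintype.bijective_iff_injective_and_card]
  constructor
  · rintro ⟨l, τ⟩ ⟨l', τ'⟩ h
    have h' : ∀ i, consPerm l τ i = consPerm l' τ' i := fun i => by
      simpa using congrArg (fun e : Equiv.Perm (Fin (n + 1)) => e i) h
    obtain rfl : l = l' := by simpa using h' 0
    have : τ = τ' := by
      ext i
      have := h' i.succ
      rw [consPerm_succ, consPerm_succ, Fin.succAbove_right_inj] at this
      rw [this]
    rw [this]
  · simp [Fintype.card_perm, Nat.factorial_succ]

lemma card_perm_succ {n : ℕ} (Q : Equiv.Perm (Fin (n + 1)) → Prop) :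
    Nat.card {σ // Q σ} = ∑ l : Fin (n + 1), Nat.card {τ // Q (consPerm l τ)} := by
  rw [← Nat.card_sigma]
  refine Nat.card_congr (Equiv.trans ?_
    (Equiv.subtypeProdEquivSigmaSubtype fun l τ => Q (consPerm l τ)))
  exact ((Equiv.ofBijective _ (consPerm_bijective n)).subtypeEquiv fun x => Iff.rfl).symm

def Free {n : ℕ} (σ : Equiv.Perm (Fin n)) : Prop :=
  ∀ i j k, i < j → j < k → σ i < σ j → ¬ σ j < σ k

/-- The values `≥ t` of `σ` appear in decreasing order. -/
def DecAbove {n : ℕ} (t : ℕ) (σ : Equiv.Perm (Fin n)) : Prop :=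
  ∀ i j, i < j → σ i < σ j → (σ i : ℕ) < t

lemma avoids123_iff_free {n : ℕ} (σ : Equiv.Perm (Fin n)) : Avoids123 σ ↔ Free σ := by
  constructor
  · intro h i j k hij hjk h1 h2
    refine h ⟨![i, j, k], ?_, ?_⟩
    · rw [Fin.strictMono_iff_lt_succ]
      intro s
      fin_cases s <;> simpa
    · have h3 := h1.trans h2
      intro s t
      fin_cases s <;> fin_cases t <;> simp [h1, h2, h3, h1.le, h2.le, h3.le]
  · rintro h ⟨i, hi, hσ⟩
    refine h (i 0) (i 1) (i 2) (hi (by decide)) (hi (by decide)) ?_ ?_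
    · rw [hσ]; decide
    · rw [hσ]; decide

lemma val_succAbove {n : ℕ} (l : Fin (n + 1)) (v : Fin n) :
    (l.succAbove v : ℕ) = if (v : ℕ) < l then (v : ℕ) else v + 1 := by
  unfold Fin.succAbove
  simp only [Fin.lt_def, Fin.val_castSucc]
  split_ifs <;> simp

/-- A `123` that uses the first entry `l` is an ascent among the later values above `l`. -/
lemma free_consPerm_iff {n : ℕ} (l : Fin (n + 1)) (τ : Equiv.Perm (Fin n)) :
    Free (consPerm l τ) ↔ Free τ ∧ DecAbove l τ := by
  constructor
  · refine fun h => ⟨fun i j k hij hjk h1 h2 => ?_, fun i j hij h1 => ?_⟩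
    · exact h i.succ j.succ k.succ (by simpa) (by simpa) (by simpa) (by simpa)
    · by_contra hl
      refine h 0 i.succ j.succ (Fin.succ_pos i) (by simpa) ?_ (by simpa)
      rw [consPerm_zero, consPerm_succ, Fin.lt_def, val_succAbove]
      split_ifs
      omega
  · rintro ⟨h, hd⟩ i j k hij hjk h1 h2
    obtain ⟨j, rfl⟩ := Fin.exists_succ_eq.2 (Fin.ne_zero_of_lt hij)
    obtain ⟨k, rfl⟩ := Fin.exists_succ_eq.2 (Fin.ne_zero_of_lt hjk)
    simp only [consPerm_succ, Fin.succAbove_lt_succAbove_iff] at h2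
    rcases Fin.eq_zero_or_eq_succ i with rfl | ⟨i, rfl⟩
    · have := hd j k (by simpa using hjk) h2
      rw [consPerm_zero, consPerm_succ, Fin.lt_def, val_succAbove] at h1
      split_ifs at h1; omega
    · simp only [consPerm_succ, Fin.succAbove_lt_succAbove_iff] at h1
      exact h i j k (by simpa using hij) (by simpa using hjk) h1 h2

/-- The threshold drops to `l`: every ascent of the new permutation starts at `l` itself or below
`l`, hence below `t`. -/
lemma consPerm_iff_of_lt {n : ℕ} {l : Fin (n + 1)} {t : ℕ} (hl : (l : ℕ) < t)
    (τ : Equiv.Perm (Fin n)) :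
    Free (consPerm l τ) ∧ DecAbove t (consPerm l τ) ↔ Free τ ∧ DecAbove l τ := by
  rw [free_consPerm_iff, and_iff_left_iff_imp]
  rintro ⟨-, hd⟩ i j hij h
  obtain ⟨j, rfl⟩ := Fin.exists_succ_eq.2 (Fin.ne_zero_of_lt hij)
  rcases Fin.eq_zero_or_eq_succ i with rfl | ⟨i, rfl⟩
  · simpa
  · simp only [consPerm_succ, Fin.succAbove_lt_succAbove_iff] at h
    have := hd i j (by simpa using hij) h
    rw [consPerm_succ, val_succAbove, if_pos this]
    omega

/-- A value larger than `l` would come later and form an ascent starting at `l ≥ t`, so `l` is the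
maximum. A leading maximum starts no ascent and leaves the threshold unchanged. -/
lemma consPerm_iff_of_le {n : ℕ} {l : Fin (n + 1)} {t : ℕ} (hl : t ≤ l)
    (τ : Equiv.Perm (Fin n)) :
    Free (consPerm l τ) ∧ DecAbove t (consPerm l τ) ↔
      (l : ℕ) = n ∧ Free τ ∧ DecAbove t τ := by
  rw [free_consPerm_iff]
  constructor
  · rintro ⟨⟨h, -⟩, hd⟩
    have hln : (l : ℕ) = n := by
      by_contra hne
      have hlt : (l : ℕ) < n := by omega
      obtain ⟨i, hi⟩ := τ.surjective ⟨l, hlt⟩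
      have := hd 0 i.succ (Fin.succ_pos i) (by
        rw [consPerm_zero, consPerm_succ, Fin.lt_def, val_succAbove, hi]; simp)
      rw [consPerm_zero] at this
      omega
    refine ⟨hln, h, fun i j hij hτ => ?_⟩
    have := hd i.succ j.succ (by simpa) (by simpa)
    rw [consPerm_succ, val_succAbove] at this
    split_ifs at this <;> omega
  · rintro ⟨hln, h, hd⟩
    refine ⟨⟨h, fun i j _ _ => by omega⟩, fun i j hij hσ => ?_⟩
    obtain ⟨j, rfl⟩ := Fin.exists_succ_eq.2 (Fin.ne_zero_of_lt hij)
    rcases Fin.eq_zero_or_eq_succ i with rfl | ⟨i, rfl⟩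
    · rw [consPerm_zero, Fin.lt_def] at hσ
      omega
    · simp only [consPerm_succ, Fin.succAbove_lt_succAbove_iff] at hσ
      have := hd i j (by simpa using hij) hσ
      rw [consPerm_succ, val_succAbove]
      split_ifs <;> omega

/-! ### Ballot numbers and their recurrence -/

/-- A ballot number, in the form given by the reflection principle. -/
def ballot (j e s : ℕ) : ℤ := (s + j).choose j - (s + j).choose (j + 1 + e)

lemma sum_ballot (j e s : ℕ) :
    ∑ i ∈ Finset.range s, ballot j e i = (s + j).choose (j + 1) - (s + j).choose (j + 2 + e) := by
  induction s with
  | zero => simp [Nat.choose_eq_zero_of_lt (show j < j + 2 + e by omega)]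
  | succ s ih =>
    rw [Finset.sum_range_succ, ih, ballot, show s + 1 + j = (s + j) + 1 by ring,
      Nat.choose_succ_succ, show j + 2 + e = (j + 1 + e) + 1 by ring, Nat.choose_succ_succ]
    push_cast
    ring

/-- This is the recurrence met by the permutation counts. The cut-off `s ≤ j + e` is harmless
because the ballot number vanishes on the boundary `s = j + 1 + e`. -/
lemma sum_ballot_add (j e s : ℕ) (hs : s ≤ j + 1 + e) :
    (∑ i ∈ Finset.range s, ballot j e i + if s ≤ j + e then ballot j e s else 0) =
      ballot (j + 1) e s := by
  have key : ∑ i ∈ Finset.range (s + 1), ballot j e i = ballot (j + 1) e s := by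
    rw [sum_ballot, ballot, show s + 1 + j = s + (j + 1) by ring,
      show j + 2 + e = j + 1 + 1 + e by ring]
  rw [← key, Finset.sum_range_succ]
  split_ifs with h
  · rfl
  · obtain rfl : s = j + 1 + e := by omega
    rw [ballot, Nat.choose_symm_of_eq_add (show j + 1 + e + j = j + (j + 1 + e) by ring)]
    simp

lemma sum_range_ite_lt (A : ℕ → ℤ) (b : ℤ) {n t : ℕ} (ht : t ≤ n + 1) :
    ∑ l ∈ Finset.range (n + 1), (if l < t then A l else if l = n then b else 0) =
      ∑ l ∈ Finset.range t, A l + if t ≤ n then b else 0 := by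
  rcases ht.eq_or_lt with rfl | h
  · simp only [show ¬ n + 1 ≤ n by omega, if_false, add_zero]
    exact Finset.sum_congr rfl fun l hl => if_pos (Finset.mem_range.1 hl)
  · rw [Finset.sum_range_succ, if_neg (by omega), if_pos rfl, if_pos (by omega)]
    congr 1
    rw [← Finset.sum_subset (Finset.range_mono (show t ≤ n by omega))]
    · exact Finset.sum_congr rfl fun l hl => if_pos (Finset.mem_range.1 hl)
    · intro l hl hl'
      rw [Finset.mem_range] at hl hl'
      rw [if_neg hl', if_neg (by omega)]

/-- The parameter `t` makes the count recursive: the first value determines the threshold imposed on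
the rest. -/
noncomputable def cardDec (n t : ℕ) : ℕ :=
  Nat.card {σ : Equiv.Perm (Fin n) // Free σ ∧ DecAbove t σ}

lemma cardDec_succ (n t : ℕ) (ht : t ≤ n + 1) :
    (cardDec (n + 1) t : ℤ) =
      ∑ l ∈ Finset.range t, (cardDec n l : ℤ) + if t ≤ n then (cardDec n t : ℤ) else 0 := by
  rw [← sum_range_ite_lt _ _ ht, ← Fin.sum_univ_eq_sum_range
    (fun l => if l < t then (cardDec n l : ℤ) else if l = n then (cardDec n t : ℤ) else 0),
    cardDec, card_perm_succ, Nat.cast_sum]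
  refine Finset.sum_congr rfl fun l _ => ?_
  split_ifs with h1 h2
  · simp only [consPerm_iff_of_lt h1, cardDec]
  · simp only [consPerm_iff_of_le (not_lt.1 h1), cardDec, h2, true_and]
  · simp only [consPerm_iff_of_le (not_lt.1 h1), h2, false_and]
    simp

lemma cardDec_eq (n t : ℕ) (ht : t ≤ n) : (cardDec n t : ℤ) = ballot n 0 t := by
  induction n generalizing t with
  | zero =>
    obtain rfl : t = 0 := by omega
    have : ∀ σ : Equiv.Perm (Fin 0), Free σ ∧ DecAbove 0 σ :=
      fun σ => ⟨fun i => i.elim0, fun i => i.elim0⟩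
    simp [cardDec, ballot, this]
  | succ n ih =>
    rw [cardDec_succ n t ht, ← sum_ballot_add n 0 t ht]
    congr 1
    · exact Finset.sum_congr rfl fun l hl => ih l (by rw [Finset.mem_range] at hl; omega)
    · simp only [add_zero]
      split_ifs with h
      · exact ih t h
      · rfl

/-! ### Counting permutations through a prescribed point -/

noncomputable def cardDecAt (n t j k : ℕ) : ℕ :=
  Nat.card {σ : Equiv.Perm (Fin n) // (Free σ ∧ DecAbove t σ) ∧
    ∃ p : Fin n, (p : ℕ) = j ∧ (σ p : ℕ) = k}

lemma cardDecAt_zero (n t k : ℕ) (hk : k < t) (hn : k ≤ n) :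
    cardDecAt (n + 1) t 0 k = cardDec n k := by
  have h0 : ∀ σ : Equiv.Perm (Fin (n + 1)),
      (∃ p : Fin (n + 1), (p : ℕ) = 0 ∧ (σ p : ℕ) = k) ↔ (σ 0 : ℕ) = k := by
    intro σ
    constructor
    · rintro ⟨p, hp, h⟩
      obtain rfl : p = 0 := Fin.ext hp
      exact h
    · exact fun h => ⟨0, rfl, h⟩
  simp only [cardDecAt, h0, card_perm_succ, consPerm_zero]
  rw [Finset.sum_eq_single (⟨k, by omega⟩ : Fin (n + 1))]
  · rw [cardDec]
    simp only [and_true]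
    exact Nat.card_congr (Equiv.subtypeEquivRight fun τ =>
      consPerm_iff_of_lt (l := ⟨k, by omega⟩) hk τ)
  · intro l _ hl
    have : (l : ℕ) ≠ k := fun h => hl (Fin.ext h)
    simp [this]
  · simp

lemma exists_consPerm_iff {n : ℕ} (l : Fin (n + 1)) (τ : Equiv.Perm (Fin n)) (j k : ℕ) :
    (∃ p : Fin (n + 1), (p : ℕ) = j + 1 ∧ (consPerm l τ p : ℕ) = k) ↔
      ∃ p : Fin n, (p : ℕ) = j ∧ (l.succAbove (τ p) : ℕ) = k := by
  constructor
  · rintro ⟨p, hp, h⟩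
    obtain ⟨p, rfl⟩ := Fin.exists_succ_eq.2 (show p ≠ 0 by rintro rfl; simp at hp)
    exact ⟨p, by simpa using hp, by simpa using h⟩
  · rintro ⟨p, hp, h⟩
    exact ⟨p.succ, by simpa using hp, by simpa using h⟩

/-- All entries after position `p` are smaller than `τ p`, since a larger one would form an ascent
above the threshold. So the `n - 1 - p` later entries fit below `τ p`. -/
lemma le_of_decAbove {n : ℕ} (τ : Equiv.Perm (Fin n)) {l : ℕ} (hd : DecAbove l τ) (p : Fin n)
    (hp : l ≤ τ p) : n ≤ p + τ p + 1 := by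
  have hmap : ∀ i ∈ Finset.Ioi p, τ i ∈ Finset.Iio (τ p) := by
    intro i hi
    rw [Finset.mem_Ioi] at hi
    rw [Finset.mem_Iio]
    by_contra hlt
    have hne : τ p ≠ τ i := fun h => hi.ne (τ.injective h)
    have := hd p i hi (lt_of_le_of_ne (not_lt.1 hlt) hne)
    omega
  have := Finset.card_le_card_of_injOn τ hmap τ.injective.injOn
  rw [Fin.card_Ioi, Fin.card_Iio] at this
  omega

/-- For `l > k`, removing the first value `l` does not shift the value `k`, so the recursion keeps
the target value and moves its position one step left. First values `l ≤ k` contribute nothing below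
the anti-diagonal. -/
lemma cardDecAt_succ (n t j k : ℕ) (ht : t ≤ n + 1) (hjk : j + 1 + k ≤ n) :
    (cardDecAt (n + 1) t (j + 1) k : ℤ) =
      ∑ l ∈ Finset.range t, (if k < l then (cardDecAt n l j k : ℤ) else 0) +
        if t ≤ n then (cardDecAt n t j k : ℤ) else 0 := by
  rw [← sum_range_ite_lt _ _ ht, ← Fin.sum_univ_eq_sum_range
    (fun l => if l < t then (if k < l then (cardDecAt n l j k : ℤ) else 0) else
      if l = n then (cardDecAt n t j k : ℤ) else 0),
    cardDecAt, card_perm_succ, Nat.cast_sum]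
  refine Finset.sum_congr rfl fun l _ => ?_
  have hgt : k < l → ∀ v : Fin n, (l.succAbove v : ℕ) = k ↔ (v : ℕ) = k := by
    intro h v
    rw [val_succAbove]
    split_ifs <;> omega
  simp only [exists_consPerm_iff]
  split_ifs with h1 h2 h2
  · simp only [consPerm_iff_of_lt h1, cardDecAt, hgt h2]
  · simp only [consPerm_iff_of_lt h1]
    rw [Nat.cast_eq_zero, Nat.card_eq_zero]
    refine Or.inl ⟨?_⟩
    rintro ⟨τ, ⟨-, hd⟩, p, hp, hk⟩
    rw [val_succAbove] at hk
    -- The prescribed entry becomes `k - 1 ≥ l` in `τ`, which forces `n ≤ j + k`, against `hjk`.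
    have := le_of_decAbove τ hd p (by split_ifs at hk <;> omega)
    split_ifs at hk <;> omega
  · simp only [consPerm_iff_of_le (not_lt.1 h1), cardDecAt, h2, true_and]
    simp only [hgt (show k < l by omega)]
  · simp only [consPerm_iff_of_le (not_lt.1 h1), h2, false_and]
    simp

/-- The `j` prepended values obey the ballot recurrence in the shifted threshold `s = t - k - 1`.
When the prescribed position is reached, the value `k` becomes the threshold for the remaining `k +
e` entries, which contribute the constant second factor. -/
lemma cardDecAt_eq (j k e s : ℕ) (hs : s ≤ j + e) :
    (cardDecAt (j + k + 1 + e) (k + 1 + s) j k : ℤ) = ballot j e s * ballot (k + e) 0 k := by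
  induction j generalizing s with
  | zero =>
    rw [show 0 + k + 1 + e = (k + e) + 1 by ring, cardDecAt_zero _ _ _ (by omega) (by omega),
      cardDec_eq _ _ (by omega)]
    simp [ballot, Nat.choose_eq_zero_of_lt (show s < 1 + e by omega)]
  | succ j ih =>
    rw [show j + 1 + k + 1 + e = (j + k + 1 + e) + 1 by ring,
      cardDecAt_succ _ _ _ _ (by omega) (by omega), ← sum_ballot_add j e s (by omega), add_mul,
      Finset.sum_mul]
    congr 1
    · rw [Finset.sum_range_add, Finset.sum_eq_zero, zero_add]
      · refine Finset.sum_congr rfl fun i hi => ?_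
        rw [Finset.mem_range] at hi
        rw [if_pos (by omega), ih i (by omega)]
      · intro l hl
        rw [Finset.mem_range] at hl
        rw [if_neg (by omega)]
    · rw [ite_mul, zero_mul]
      by_cases h : s ≤ j + e
      · rw [if_pos h, if_pos (by omega), ih s h]
      · rw [if_neg h, if_neg (by omega)]

lemma ballot_mul (j e : ℕ) :
    ballot j e (j + e) * (j + e + 1) = (e + 1) * (j + e + j).choose j := by
  have h1 := Nat.choose_succ_right_eq (j + e + j) (j + e)
  rw [show j + e + j - (j + e) = j by omega,
    Nat.choose_symm_of_eq_add (show j + e + j = (j + e) + j by ring)] at h1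
  rw [ballot, sub_mul, show j + 1 + e = j + e + 1 by ring]
  have h2 : ((j + e + j).choose (j + e + 1) : ℤ) * (j + e + 1) = (j + e + j).choose j * j := by
    exact_mod_cast h1
  rw [h2]
  ring

lemma cardDecAt_mul (j k e : ℕ) :
    cardDecAt (j + k + 1 + e) (j + k + 1 + e) j k * ((j + e + 1) * (k + e + 1)) =
      (e + 1) ^ 2 * ((j + e + j).choose j * (k + e + k).choose k) := by
  have h := cardDecAt_eq j k e (j + e) le_rfl
  rw [show k + 1 + (j + e) = j + k + 1 + e by ring] at h
  have h1 := ballot_mul j e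
  have h2 := ballot_mul k e
  -- Symmetry of the binomial coefficient brings the second factor to the form of the first.
  have h3 : ballot (k + e) 0 k = ballot k e (k + e) := by
    rw [ballot, ballot, show k + (k + e) = k + e + k by ring,
      Nat.choose_symm_of_eq_add (show k + e + k = (k + e) + k by ring),
      show k + e + 1 + 0 = k + 1 + e by ring]
  rw [h3] at h
  zify
  rw [h]
  linear_combination (ballot k e (k + e) * (k + e + 1)) * h1 +
    ((e + 1) * ((j + e + j).choose j : ℤ)) * h2

/-! ### Reverse-complement symmetry and the closed form -/

lemma P_eq_cardDecAt (n j k : ℕ) : P n (j + 1) (k + 1) = cardDecAt n n j k := by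
  refine Nat.card_congr (Equiv.subtypeEquivRight fun σ => ?_)
  rw [avoids123_iff_free]
  have hd : DecAbove n σ := fun i _ _ _ => (σ i).2
  simp only [hd, and_true, add_left_inj, Nat.cast_inj]

lemma free_rev {n : ℕ} (σ : Equiv.Perm (Fin n)) (h : Free σ) :
    Free (Fin.revPerm.trans (σ.trans Fin.revPerm)) := by
  intro i j k hij hjk h1 h2
  simp only [Equiv.trans_apply, Fin.revPerm_apply, Fin.rev_lt_rev] at h1 h2
  exact h k.rev j.rev i.rev (by simpa) (by simpa) h2 h1

/-- Reversing both positions and values preserves `123` and exchanges the two sides of the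
anti-diagonal. -/
lemma P_reflect (n : ℕ) (j k : ℤ) : P n (n + 1 - j) (n + 1 - k) = P n j k := by
  let Φ : Equiv.Perm (Fin n) ≃ Equiv.Perm (Fin n) :=
    ⟨fun σ => Fin.revPerm.trans (σ.trans Fin.revPerm),
      fun σ => Fin.revPerm.trans (σ.trans Fin.revPerm),
      fun σ => by ext; simp, fun σ => by ext; simp⟩
  refine Nat.card_congr (Φ.subtypeEquiv fun σ => ?_)
  rw [avoids123_iff_free, avoids123_iff_free]
  refine and_congr ⟨free_rev σ, fun h => ?_⟩ ?_
  · have := free_rev _ h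
    convert this using 1
    exact (Φ.left_inv σ).symm
  · constructor
    · rintro ⟨p, hp, hk⟩
      refine ⟨p.rev, ?_, ?_⟩
      · rw [Fin.val_rev]; omega
      · simp only [Φ, Equiv.coe_fn_mk, Equiv.trans_apply, Fin.revPerm_apply, Fin.rev_rev,
          Fin.val_rev]
        omega
    · rintro ⟨p, hp, hk⟩
      refine ⟨p.rev, ?_, ?_⟩
      · rw [Fin.val_rev]; omega
      · simp only [Φ, Equiv.coe_fn_mk, Equiv.trans_apply, Fin.revPerm_apply, Fin.val_rev] at hk
        omega

/-- The closed form of `P`, where `p`, `q`, `r`, `s` are the numbers of positions before and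
after `j` and of values below and above `k`. -/
lemma P_mul (n p q r s : ℕ) (hj : p + s + 1 = n) (hk : r + q + 1 = n) :
    P n (p + 1) (r + 1) * ((max p q + 1) * (max r s + 1)) =
      (((q : ℤ) - p).natAbs + 1) ^ 2 * ((p + q).choose p * (r + s).choose r) := by
  rcases le_total p q with h | h
  · obtain ⟨e, rfl⟩ := Nat.exists_eq_add_of_le h
    obtain rfl : s = r + e := by omega
    obtain rfl : n = p + r + 1 + e := by omega
    have := cardDecAt_mul p r e
    rw [P_eq_cardDecAt, max_eq_right h, max_eq_right (by omega), this]
    have h1 : (((p + e : ℕ) : ℤ) - p).natAbs = e := by omega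
    rw [h1, add_comm p (p + e), add_comm r (r + e)]
  · obtain ⟨e, rfl⟩ := Nat.exists_eq_add_of_le h
    obtain rfl : r = s + e := by omega
    obtain rfl : n = s + q + 1 + e := by omega
    have := cardDecAt_mul s q e
    rw [← P_eq_cardDecAt, ← P_reflect] at this
    have h1 : ((q : ℤ) - ((q + e : ℕ) : ℤ)).natAbs = e := by omega
    rw [h1, max_eq_left h, max_eq_left (by omega)]
    rw [Nat.choose_symm_of_eq_add (show q + e + q = (q + e) + q by ring),
      Nat.choose_symm_of_eq_add (show s + e + s = (s + e) + s by ring)]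
    rw [show ((s + q + 1 + e : ℕ) : ℤ) + 1 - (s + 1) = ((q + e : ℕ) : ℤ) + 1 by push_cast; ring,
      show ((s + q + 1 + e : ℕ) : ℤ) + 1 - (q + 1) = ((s + e : ℕ) : ℤ) + 1 by push_cast; ring]
      at this
    linarith

/-! ### Stirling's formula and the local limit theorem -/

lemma abs_log_one_add_sub_le {x : ℝ} (hx : |x| ≤ 1 / 2) :
    |Real.log (1 + x) - x + x ^ 2 / 2| ≤ 2 * |x| ^ 3 := by
  have h := Real.abs_log_sub_add_sum_range_le (x := -x) (by rw [abs_neg]; linarith) 2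
  simp only [Finset.sum_range_succ, Finset.sum_range_zero, abs_neg, sub_neg_eq_add] at h
  norm_num at h
  have h2 : |x| ^ 3 / (1 - |x|) ≤ 2 * |x| ^ 3 := by
    rw [div_le_iff₀ (by linarith)]
    have : 0 ≤ |x| ^ 3 := by positivity
    nlinarith
  calc _ = |-x + x ^ 2 / 2 + Real.log (1 + x)| := by ring_nf
    _ ≤ _ := h.trans h2

/-- The entropy defect of the distribution `((1 - x) / 2, (1 + x) / 2)`, times two. -/
noncomputable def entropyDefect (x : ℝ) : ℝ :=
  (1 - x) * Real.log (1 - x) + (1 + x) * Real.log (1 + x)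

lemma abs_entropyDefect_sub_le {x : ℝ} (hx : |x| ≤ 1 / 2) :
    |entropyDefect x - x ^ 2| ≤ 6 * |x| ^ 3 := by
  have h1 := abs_log_one_add_sub_le hx
  have h2 := abs_log_one_add_sub_le (x := -x) (by rwa [abs_neg])
  rw [abs_neg, ← sub_eq_add_neg] at h2
  have hx' := abs_le.1 hx
  have e : entropyDefect x - x ^ 2 = (1 - x) * (Real.log (1 - x) - -x + (-x) ^ 2 / 2) +
      (1 + x) * (Real.log (1 + x) - x + x ^ 2 / 2) := by
    rw [entropyDefect]; ring
  have hpos : 0 ≤ |x| ^ 3 := by positivity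
  rw [e]
  refine (abs_add_le _ _).trans ?_
  rw [abs_mul, abs_mul, abs_of_nonneg (show 0 ≤ 1 - x by linarith),
    abs_of_nonneg (show 0 ≤ 1 + x by linarith)]
  nlinarith

lemma factorial_eq_stirlingSeq {n : ℕ} (hn : 0 < n) :
    (n.factorial : ℝ) = Stirling.stirlingSeq n * (√(2 * n) * ((n : ℝ) / Real.exp 1) ^ n) := by
  have : (0 : ℝ) < n := by exact_mod_cast hn
  have h : √(2 * (n : ℝ)) * ((n : ℝ) / Real.exp 1) ^ n ≠ 0 := by positivity
  rw [Stirling.stirlingSeq]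
  rw [div_mul_cancel₀ _ h]

lemma choose_entropy {p q : ℕ} (hp : 0 < p) (hq : 0 < q) :
    ((p : ℝ) + q) ^ (p + q) / (2 ^ (p + q) * (p : ℝ) ^ p * (q : ℝ) ^ q) =
      Real.exp (-(((p : ℝ) + q) * entropyDefect (((q : ℝ) - p) / (p + q))) / 2) := by
  have hp' : (0 : ℝ) < p := by exact_mod_cast hp
  have hq' : (0 : ℝ) < q := by exact_mod_cast hq
  have hM : (0 : ℝ) < p + q := by positivity
  have h1 : 1 - ((q : ℝ) - p) / (p + q) = 2 * p / (p + q) := by field_simp; ring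
  have h2 : 1 + ((q : ℝ) - p) / (p + q) = 2 * q / (p + q) := by field_simp; ring
  have h3 : -(((p : ℝ) + q) * entropyDefect (((q : ℝ) - p) / (p + q))) / 2 =
      (p : ℝ) * Real.log ((p + q) / (2 * p)) + q * Real.log ((p + q) / (2 * q)) := by
    rw [entropyDefect, h1, h2, ← inv_div (2 * (p : ℝ)), ← inv_div (2 * (q : ℝ)), Real.log_inv,
      Real.log_inv]
    field_simp
    ring
  rw [h3, Real.exp_add, mul_comm (p : ℝ), mul_comm (q : ℝ) (Real.log _), ← Real.rpow_def_of_pos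
    (by positivity), ← Real.rpow_def_of_pos (by positivity), Real.rpow_natCast, Real.rpow_natCast,
    div_pow, div_pow, mul_pow, mul_pow, pow_add, pow_add]
  field_simp

lemma choose_eq_stirling {p q : ℕ} (hp : 0 < p) (hq : 0 < q) :
    ((p + q).choose p : ℝ) * √((p : ℝ) + q) / 2 ^ (p + q) =
      Stirling.stirlingSeq (p + q) / (Stirling.stirlingSeq p * Stirling.stirlingSeq q) *
        (√2 / √(1 - (((q : ℝ) - p) / (p + q)) ^ 2)) *
        Real.exp (-(((p : ℝ) + q) * entropyDefect (((q : ℝ) - p) / (p + q))) / 2) := by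
  have hp' : (0 : ℝ) < p := by exact_mod_cast hp
  have hq' : (0 : ℝ) < q := by exact_mod_cast hq
  have hM : (0 : ℝ) < p + q := by positivity
  rw [← choose_entropy hp hq]
  have hS : ∀ n : ℕ, 0 < n → 0 < Stirling.stirlingSeq n := fun n hn => by
    obtain ⟨m, rfl⟩ := Nat.exists_eq_succ_of_ne_zero hn.ne'
    exact Stirling.stirlingSeq'_pos m
  have hSp := hS p hp
  have hSq := hS q hq
  have hf : ((p + q).choose p : ℝ) * p.factorial * q.factorial = (p + q).factorial := by
    rw [Nat.choose_symm_add]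
    exact_mod_cast Nat.add_choose_mul_factorial_mul_factorial p q
  rw [factorial_eq_stirlingSeq hp, factorial_eq_stirlingSeq hq,
    factorial_eq_stirlingSeq (by omega : 0 < p + q)] at hf
  -- With `x = (q - p)/(p + q)` one has `1 - x² = 4pq/(p + q)²`.
  have hx : √(1 - (((q : ℝ) - p) / (p + q)) ^ 2) = 2 * √p * √q / (p + q) := by
    rw [show 1 - (((q : ℝ) - p) / (p + q)) ^ 2 = (2 * √p * √q / (p + q)) ^ 2 by
      rw [div_pow, div_pow, mul_pow, mul_pow, Real.sq_sqrt hp'.le, Real.sq_sqrt hq'.le]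
      field_simp
      ring]
    exact Real.sqrt_sq (by positivity)
  have hC : ((p + q).choose p : ℝ) = Stirling.stirlingSeq (p + q) *
      (√(2 * (p + q : ℝ)) * (((p : ℝ) + q) / Real.exp 1) ^ (p + q)) /
      ((Stirling.stirlingSeq p * (√(2 * p) * ((p : ℝ) / Real.exp 1) ^ p)) *
       (Stirling.stirlingSeq q * (√(2 * q) * ((q : ℝ) / Real.exp 1) ^ q))) := by
    rw [eq_div_iff (by positivity), ← mul_assoc]
    push_cast at hf
    exact hf
  rw [hC, hx, Real.sqrt_mul (by norm_num), Real.sqrt_mul (by norm_num),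
    Real.sqrt_mul (by norm_num), div_pow, div_pow, div_pow, pow_add (Real.exp 1)]
  have hs : √((p : ℝ) + q) * √((p : ℝ) + q) = p + q := Real.mul_self_sqrt hM.le
  have h2 : √(2 : ℝ) * √2 = 2 := Real.mul_self_sqrt (by norm_num)
  have e1 : (0 : ℝ) < √p := Real.sqrt_pos.2 hp'
  have e2 : (0 : ℝ) < √q := Real.sqrt_pos.2 hq'
  have e3 : (0 : ℝ) < √2 := Real.sqrt_pos.2 two_pos
  field_simp
  rw [show √((p : ℝ) + q) ^ 2 = p + q by rw [sq, hs], show √(2 : ℝ) ^ 2 = 2 by rw [sq, h2]]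
  ring

/-- The local central limit theorem for the symmetric binomial distribution. -/
lemma tendsto_choose (p q : ℕ → ℕ) (hp : Tendsto p atTop atTop) (hq : Tendsto q atTop atTop)
    {lam : ℝ} (h : Tendsto (fun n => ((q n : ℝ) - p n) ^ 2 / ((p n : ℝ) + q n)) atTop (𝓝 lam)) :
    Tendsto (fun n => ((p n + q n).choose (p n) : ℝ) * √((p n : ℝ) + q n) / 2 ^ (p n + q n))
      atTop (𝓝 (√2 / √Real.pi * Real.exp (-lam / 2))) := by
  set x : ℕ → ℝ := fun n => ((q n : ℝ) - p n) / (p n + q n) with hxdef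
  have hpR : Tendsto (fun n => (p n : ℝ)) atTop atTop := tendsto_natCast_atTop_atTop.comp hp
  have hqR : Tendsto (fun n => (q n : ℝ)) atTop atTop := tendsto_natCast_atTop_atTop.comp hq
  have hM : Tendsto (fun n => (p n : ℝ) + q n) atTop atTop := hpR.atTop_add_atTop hqR
  have hMpos : ∀ᶠ n in atTop, (0 : ℝ) < p n + q n := hM.eventually_gt_atTop 0
  have hMx : Tendsto (fun n => ((p n : ℝ) + q n) * x n ^ 2) atTop (𝓝 lam) := by
    refine h.congr' ?_
    filter_upwards [hMpos] with n hn
    rw [hxdef]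
    field_simp
  have hx2 : Tendsto (fun n => x n ^ 2) atTop (𝓝 0) := by
    have := hMx.mul hM.inv_tendsto_atTop
    rw [mul_zero] at this
    refine this.congr' ?_
    filter_upwards [hMpos] with n hn
    simp only [Pi.inv_apply]
    field_simp
  have hx : Tendsto (fun n => |x n|) atTop (𝓝 0) := by
    have := hx2.sqrt
    simpa [Real.sqrt_sq_eq_abs] using this
  have hφ : Tendsto (fun n => ((p n : ℝ) + q n) * entropyDefect (x n)) atTop (𝓝 lam) := by
    -- With `M = p + q`, the cubic error is `M|x|³ = (M x²)|x|`, a convergent factor times one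
    -- tending to `0`.
    have herr : Tendsto (fun n => ((p n : ℝ) + q n) * entropyDefect (x n) -
        ((p n : ℝ) + q n) * x n ^ 2) atTop (𝓝 0) := by
      have hb : Tendsto (fun n => 6 * ((((p n : ℝ) + q n) * x n ^ 2) * |x n|)) atTop (𝓝 0) := by
        simpa using (hMx.mul hx).const_mul 6
      refine squeeze_zero_norm' ?_ hb
      filter_upwards [hMpos, hx.eventually_le_const (show (0 : ℝ) < 1 / 2 by norm_num)]
        with n hn hxn
      have := abs_entropyDefect_sub_le hxn
      rw [← mul_sub, Real.norm_eq_abs, abs_mul, abs_of_pos hn]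
      calc _ ≤ ((p n : ℝ) + q n) * (6 * |x n| ^ 3) := by gcongr
        _ = _ := by rw [← sq_abs (x n)]; ring
    simpa using herr.add hMx
  have hS : ∀ r : ℕ → ℕ, Tendsto r atTop atTop →
      Tendsto (fun n => Stirling.stirlingSeq (r n)) atTop (𝓝 √Real.pi) :=
    fun r hr => Stirling.tendsto_stirlingSeq_sqrt_pi.comp hr
  have hpi : √Real.pi ≠ 0 := (Real.sqrt_pos.2 Real.pi_pos).ne'
  have hsum : Tendsto (fun n => p n + q n) atTop atTop := hp.atTop_add_atTop hq
  have key := (((hS _ hsum).div ((hS p hp).mul (hS q hq)) (mul_ne_zero hpi hpi)).mul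
    ((tendsto_const_nhds (x := √2)).div (hx2.const_sub 1).sqrt (by simp))).mul
    ((Real.continuous_exp.tendsto _).comp (hφ.neg.div_const 2))
  have hlim : √Real.pi / (√Real.pi * √Real.pi) * (√2 / √(1 - 0)) * Real.exp (-lam / 2) =
      √2 / √Real.pi * Real.exp (-lam / 2) := by
    simp only [sub_zero, Real.sqrt_one]
    field_simp
  rw [hlim] at key
  refine key.congr' ?_
  filter_upwards [hp.eventually_gt_atTop 0, hq.eventually_gt_atTop 0] with n hpn hqn
  exact (choose_eq_stirling hpn hqn).symm

/-! ### Asymptotics of the normalized count -/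

lemma tendsto_catalan :
    Tendsto (fun n : ℕ => (catalan n : ℝ) * (n + 1) * √(2 * n) / 4 ^ n) atTop
      (𝓝 (√2 / √Real.pi)) := by
  have h := tendsto_choose id id tendsto_id tendsto_id (lam := 0) (by simp)
  simp only [neg_zero, zero_div, Real.exp_zero, mul_one] at h
  refine h.congr fun n => ?_
  have h1 := succ_mul_catalan_eq_centralBinom n
  have h2 : ((n : ℝ) + 1) * catalan n = (n + n).choose n := by
    rw [Nat.centralBinom, two_mul] at h1
    exact_mod_cast h1
  simp only [id]
  rw [← h2, ← two_mul (n : ℝ), ← two_mul n, pow_mul]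
  rw [show (2 : ℝ) ^ 2 = 4 by norm_num]
  ring

/-- The limit of `n^(3/2) P_n / (C_n (|n + 1 - j - k| + 1)^2)`. -/
noncomputable def profile (a μ : ℝ) : ℝ :=
  Real.exp (-μ / (4 * (a * (1 - a)))) / (4 * √Real.pi * (a * (1 - a)) ^ (3 / 2 : ℝ))

lemma rpow_three_halves {x : ℝ} (hx : 0 ≤ x) : x ^ (3 / 2 : ℝ) = x * √x := by
  rw [show (3 / 2 : ℝ) = 1 + 1 / 2 by norm_num,
    Real.rpow_add' hx (by norm_num), Real.rpow_one, ← Real.sqrt_eq_rpow]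

lemma profile_pos {a : ℝ} (ha₀ : 0 < a) (ha₁ : a < 1) (μ : ℝ) : 0 < profile a μ := by
  have : 0 < a * (1 - a) := mul_pos ha₀ (by linarith)
  rw [profile]
  positivity

lemma tendsto_nat_of_div {u : ℕ → ℝ} {b : ℝ} (hb : 0 < b)
    (h : Tendsto (fun n : ℕ => u n / n) atTop (𝓝 b)) : Tendsto u atTop atTop := by
  refine (h.pos_mul_atTop hb (tendsto_natCast_atTop_atTop (R := ℝ))).congr' ?_
  filter_upwards [eventually_gt_atTop 0] with n hn
  have : (n : ℝ) ≠ 0 := by exact_mod_cast hn.ne'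
  field_simp

lemma tendsto_add_const_div {u : ℕ → ℝ} {b : ℝ}
    (h : Tendsto (fun n : ℕ => u n / n) atTop (𝓝 b)) (d : ℝ) :
    Tendsto (fun n : ℕ => (u n + d) / n) atTop (𝓝 b) := by
  have := h.add (tendsto_const_div_atTop_nhds_zero_nat d)
  simpa only [add_zero, ← add_div] using this

lemma tendsto_sq_div_add {p q : ℕ → ℕ} {b μ : ℝ} (hb : 0 < b)
    (hp : Tendsto (fun n => (p n : ℝ) / n) atTop (𝓝 b))
    (hq : Tendsto (fun n => (q n : ℝ) / n) atTop (𝓝 b))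
    (hδ : Tendsto (fun n => ((q n : ℝ) - p n) ^ 2 / n) atTop (𝓝 μ)) :
    Tendsto (fun n => ((q n : ℝ) - p n) ^ 2 / ((p n : ℝ) + q n)) atTop (𝓝 (μ / (b + b))) := by
  refine (hδ.div (hp.add hq) (by positivity)).congr' ?_
  filter_upwards [eventually_gt_atTop 0] with n hn
  have : (n : ℝ) ≠ 0 := by exact_mod_cast hn.ne'
  simp only [Pi.div_apply, ← add_div]
  rw [div_div_div_cancel_right₀ this]

lemma tendsto_div_max_add_one {p q : ℕ → ℕ} {b : ℝ} (hb : 0 < b)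
    (hp : Tendsto (fun n => (p n : ℝ) / n) atTop (𝓝 b))
    (hq : Tendsto (fun n => (q n : ℝ) / n) atTop (𝓝 b)) :
    Tendsto (fun n : ℕ => (n : ℝ) / (max (p n : ℝ) (q n) + 1)) atTop (𝓝 b⁻¹) := by
  have h : Tendsto (fun n : ℕ => max (p n : ℝ) (q n) / n) atTop (𝓝 b) := by
    have := hp.max hq
    rw [max_self] at this
    refine this.congr fun n => ?_
    rw [max_div_div_right (Nat.cast_nonneg n)]
  refine ((tendsto_add_const_div h 1).inv₀ hb.ne').congr fun n => ?_
  rw [inv_div]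

lemma tendsto_sqrt_div_add {p q : ℕ → ℕ} {b : ℝ} (hb : 0 < b)
    (hp : Tendsto (fun n => (p n : ℝ) / n) atTop (𝓝 b))
    (hq : Tendsto (fun n => (q n : ℝ) / n) atTop (𝓝 b)) :
    Tendsto (fun n : ℕ => √n / √((p n : ℝ) + q n)) atTop (𝓝 (√(b + b))⁻¹) := by
  have h := ((hp.add hq).sqrt).inv₀ (Real.sqrt_pos.2 (by positivity : 0 < b + b)).ne'
  refine h.congr fun n => ?_
  rw [← add_div, Real.sqrt_div (by positivity), inv_div]

lemma tendsto_profile_aux {a μ : ℝ} (ha₀ : 0 < a) (ha₁ : a < 1) (p q r s : ℕ → ℕ)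
    (hj : ∀ᶠ n in atTop, p n + s n + 1 = n) (hk : ∀ᶠ n in atTop, r n + q n + 1 = n)
    (hp : Tendsto (fun n => (p n : ℝ) / n) atTop (𝓝 a))
    (hq : Tendsto (fun n => (q n : ℝ) / n) atTop (𝓝 a))
    (hr : Tendsto (fun n => (r n : ℝ) / n) atTop (𝓝 (1 - a)))
    (hs : Tendsto (fun n => (s n : ℝ) / n) atTop (𝓝 (1 - a)))
    (hδ : Tendsto (fun n => ((q n : ℝ) - p n) ^ 2 / n) atTop (𝓝 μ)) :
    Tendsto (fun n : ℕ => (n : ℝ) ^ (3 / 2 : ℝ) * P n (p n + 1) (r n + 1) /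
      (catalan n * (|(q n : ℝ) - p n| + 1) ^ 2)) atTop (𝓝 (profile a μ)) := by
  have hb : 0 < 1 - a := by linarith
  have hδ' : Tendsto (fun n => ((s n : ℝ) - r n) ^ 2 / n) atTop (𝓝 μ) := by
    refine hδ.congr' ?_
    filter_upwards [hj, hk] with n h1 h2
    have h3 : (p n : ℝ) + s n = r n + q n := by
      have : p n + s n = r n + q n := by omega
      exact_mod_cast this
    rw [show (q n : ℝ) - p n = s n - r n by linarith]
  have htop : ∀ {u : ℕ → ℕ} {b : ℝ}, 0 < b → Tendsto (fun n => (u n : ℝ) / n) atTop (𝓝 b) →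
      Tendsto u atTop atTop := fun hb h =>
    tendsto_natCast_atTop_iff.1 (tendsto_nat_of_div hb h)
  have hA := tendsto_choose p q (htop ha₀ hp) (htop ha₀ hq) (tendsto_sq_div_add ha₀ hp hq hδ)
  have hB := tendsto_choose r s (htop hb hr) (htop hb hs) (tendsto_sq_div_add hb hr hs hδ')
  have hpi : 0 < √Real.pi := Real.sqrt_pos.2 Real.pi_pos
  have h2 : 0 < √(2 : ℝ) := Real.sqrt_pos.2 two_pos
  have hn1 : Tendsto (fun n : ℕ => ((n : ℝ) + 1) / n) atTop (𝓝 1) := by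
    refine tendsto_add_const_div (u := fun n => (n : ℝ)) ?_ 1
    refine tendsto_const_nhds.congr' ?_
    filter_upwards [eventually_gt_atTop 0] with n hn
    rw [div_self (by exact_mod_cast hn.ne')]
  -- The constant `√2 / 4` absorbs the `√2` of `√(2n)` in the Catalan asymptotics and the `4` in
  -- `4^n = 4 · 2^(p+q) · 2^(r+s)`, which holds because `p + q + r + s = 2(n - 1)`.
  have key := ((((((hA.mul hB).div tendsto_catalan (by positivity)).mul
    (tendsto_sqrt_div_add ha₀ hp hq)).mul (tendsto_sqrt_div_add hb hr hs)).mul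
    (tendsto_div_max_add_one ha₀ hp hq)).mul (tendsto_div_max_add_one hb hr hs)).mul hn1 |>.mul_const
    (√2 / 4)
  have hlim : √2 / √Real.pi * Real.exp (-(μ / (a + a)) / 2) *
      (√2 / √Real.pi * Real.exp (-(μ / (1 - a + (1 - a))) / 2)) / (√2 / √Real.pi) *
      (√(a + a))⁻¹ * (√(1 - a + (1 - a)))⁻¹ * a⁻¹ * (1 - a)⁻¹ * 1 * (√2 / 4) = profile a μ := by
    have he : Real.exp (-μ / (4 * (a * (1 - a)))) = Real.exp (-(μ / (a + a)) / 2) *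
        Real.exp (-(μ / (1 - a + (1 - a))) / 2) := by
      rw [← Real.exp_add]
      congr 1
      have := hb.ne'
      rw [← two_mul, ← two_mul]
      field_simp
      ring
    have h22 : √(2 : ℝ) * √2 = 2 := Real.mul_self_sqrt (by norm_num)
    rw [profile, he, rpow_three_halves (by positivity), Real.sqrt_mul ha₀.le, ← two_mul, ← two_mul,
      Real.sqrt_mul (by norm_num), Real.sqrt_mul (by norm_num)]
    have e1 : 0 < √a := Real.sqrt_pos.2 ha₀
    have e2 : 0 < √(1 - a) := Real.sqrt_pos.2 hb
    field_simp
  rw [hlim] at key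
  refine key.congr' ?_
  filter_upwards [hj, hk, eventually_gt_atTop 0, (htop ha₀ hp).eventually_gt_atTop 0,
    (htop hb hr).eventually_gt_atTop 0] with n hjn hkn hn hpn hrn
  have hn' : (0 : ℝ) < n := by exact_mod_cast hn
  have hp' : (0 : ℝ) < p n := by exact_mod_cast hpn
  have hr' : (0 : ℝ) < r n := by exact_mod_cast hrn
  have hP := P_mul n (p n) (q n) (r n) (s n) hjn hkn
  have hPR : (P n (p n + 1) (r n + 1) : ℝ) *
      ((max (p n : ℝ) (q n) + 1) * (max (r n : ℝ) (s n) + 1)) =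
      (|(q n : ℝ) - p n| + 1) ^ 2 *
        (((p n + q n).choose (p n) : ℝ) * ((r n + s n).choose (r n) : ℝ)) := by
    have := congrArg (Nat.cast : ℕ → ℝ) hP
    push_cast [Nat.cast_natAbs] at this
    exact this
  have hm1 : 0 < max (p n : ℝ) (q n) + 1 := by positivity
  have hm2 : 0 < max (r n : ℝ) (s n) + 1 := by positivity
  have hPR' : (P n (p n + 1) (r n + 1) : ℝ) = (|(q n : ℝ) - p n| + 1) ^ 2 *
        (((p n + q n).choose (p n) : ℝ) * ((r n + s n).choose (r n) : ℝ)) /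
      ((max (p n : ℝ) (q n) + 1) * (max (r n : ℝ) (s n) + 1)) := by
    rw [eq_div_iff (by positivity), hPR]
  have hcat : (0 : ℝ) < catalan n := by
    have h1 := succ_mul_catalan_eq_centralBinom n
    have h3 := Nat.centralBinom_pos n
    rw [← h1] at h3
    exact_mod_cast Nat.pos_of_mul_pos_left h3
  have hpow : (4 : ℝ) ^ n = 4 * (2 ^ (p n + q n) * 2 ^ (r n + s n)) := by
    rw [show (4 : ℝ) = 2 ^ 2 by norm_num, ← pow_mul, ← pow_add, ← pow_add]
    congr 1
    omega
  simp only [Pi.div_apply]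
  rw [hPR', hpow, rpow_three_halves hn'.le, Real.sqrt_mul (by norm_num)]
  have f1 : 0 < √((p n : ℝ) + q n) := Real.sqrt_pos.2 (by positivity)
  have f2 : 0 < √((r n : ℝ) + s n) := Real.sqrt_pos.2 (by positivity)
  have f3 : 0 < √(n : ℝ) := Real.sqrt_pos.2 hn'
  have hd : 0 < |(q n : ℝ) - p n| + 1 := by positivity
  field_simp

lemma tendsto_profile {a μ : ℝ} (ha₀ : 0 < a) (ha₁ : a < 1) (j k : ℕ → ℤ)
    (hj : Tendsto (fun n : ℕ => (j n : ℝ) / n) atTop (𝓝 a))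
    (hk : Tendsto (fun n : ℕ => (k n : ℝ) / n) atTop (𝓝 (1 - a)))
    (hδ : Tendsto (fun n : ℕ => ((n : ℝ) + 1 - j n - k n) ^ 2 / n) atTop (𝓝 μ)) :
    Tendsto (fun n : ℕ => (n : ℝ) ^ (3 / 2 : ℝ) * P n (j n) (k n) /
      (catalan n * (|(n : ℝ) + 1 - j n - k n| + 1) ^ 2)) atTop (𝓝 (profile a μ)) := by
  have hn1 : Tendsto (fun n : ℕ => (n : ℝ) / n) atTop (𝓝 1) := by
    refine tendsto_const_nhds.congr' ?_
    filter_upwards [eventually_gt_atTop 0] with n hn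
    rw [div_self (by exact_mod_cast hn.ne')]
  have hcompl : ∀ {u : ℕ → ℝ} {b : ℝ}, Tendsto (fun n : ℕ => u n / n) atTop (𝓝 b) →
      Tendsto (fun n : ℕ => ((n : ℝ) - u n) / n) atTop (𝓝 (1 - b)) := fun h => by
    simpa only [← sub_div] using hn1.sub h
  have hpos : ∀ {u : ℕ → ℤ} {b : ℝ}, 0 < b → Tendsto (fun n : ℕ => (u n : ℝ) / n) atTop (𝓝 b) →
      ∀ᶠ n in atTop, 1 ≤ u n := fun hb h => by
    filter_upwards [(tendsto_nat_of_div hb h).eventually_ge_atTop 1] with n hn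
    exact_mod_cast hn
  have hb : 0 < 1 - a := by linarith
  have hj1 := hpos ha₀ hj
  have hk1 := hpos hb hk
  have hjn : ∀ᶠ n : ℕ in atTop, 1 ≤ (n : ℤ) - j n :=
    hpos (u := fun n => (n : ℤ) - j n) hb (by simpa using hcompl hj)
  have hkn : ∀ᶠ n : ℕ in atTop, 1 ≤ (n : ℤ) - k n :=
    hpos (u := fun n => (n : ℤ) - k n) ha₀ (by simpa using hcompl hk)
  -- Eventually `j` and `k` lie in `[1, n - 1]`, so no `toNat` below truncates.
  have hall := hj1.and (hk1.and (hjn.and hkn))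
  have cast_pred : ∀ m : ℤ, 1 ≤ m → (((m - 1).toNat : ℕ) : ℝ) = m + -1 := fun m hm => by
    rw [← Int.cast_natCast, Int.toNat_of_nonneg (by omega)]
    push_cast
    ring
  have cast_compl : ∀ (n : ℕ) (m : ℤ), 1 ≤ (n : ℤ) - m → ((((n : ℤ) - m).toNat : ℕ) : ℝ) = n - m :=
    fun n m hm => by
      rw [← Int.cast_natCast, Int.toNat_of_nonneg (by omega)]
      push_cast
      ring
  have main := tendsto_profile_aux (μ := μ) ha₀ ha₁ (fun n => (j n - 1).toNat)
    (fun n => ((n : ℤ) - k n).toNat) (fun n => (k n - 1).toNat) (fun n => ((n : ℤ) - j n).toNat)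
    (by filter_upwards [hall] with n hn; omega) (by filter_upwards [hall] with n hn; omega)
    ((tendsto_add_const_div hj (-1)).congr' (by
      filter_upwards [hj1] with n hn; rw [cast_pred _ hn]))
    (by
      have := hcompl hk
      rw [sub_sub_cancel] at this
      refine this.congr' ?_
      filter_upwards [hkn] with n hn; rw [cast_compl _ _ hn])
    ((tendsto_add_const_div hk (-1)).congr' (by
      filter_upwards [hk1] with n hn; rw [cast_pred _ hn]))
    ((hcompl hj).congr' (by
      filter_upwards [hjn] with n hn; rw [cast_compl _ _ hn]))
    (hδ.congr' (by
      filter_upwards [hall] with n hn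
      rw [cast_pred _ hn.1, cast_compl _ _ hn.2.2.2]
      ring_nf))
  refine main.congr' ?_
  filter_upwards [hall] with n hn
  rw [cast_pred _ hn.1, cast_compl _ _ hn.2.2.2, Int.toNat_of_nonneg (by omega),
    Int.toNat_of_nonneg (by omega), sub_add_cancel, sub_add_cancel,
    show (n : ℝ) - k n - (j n + -1) = n + 1 - j n - k n by ring]

/-! ### Identifying the exponent -/

lemma scaled_eq_rpow_mul (j k : ℕ → ℤ) (d β : ℝ) {n : ℕ} (hn : 0 < n) :
    scaled j k d n = (n : ℝ) ^ (d - β) * scaled j k β n := by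
  have hn' : (0 : ℝ) < n := by exact_mod_cast hn
  rw [scaled, scaled, ← mul_div_assoc, ← mul_assoc, ← Real.rpow_add hn', sub_add_cancel]

/-- Larger exponents than `β` force divergence to infinity, smaller ones force the limit `0`.
Convergence at `β` itself is not needed, so the lemma covers roundings for which the scaled sequence
oscillates. -/
lemma F_eq (j k : ℕ → ℤ) {β B ε : ℝ} (hβ : 0 ≤ β) (hε : 0 < ε)
    (hB : ∀ᶠ n in atTop, scaled j k β n ≤ B) (hlow : ∀ᶠ n in atTop, ε ≤ scaled j k β n) :
    F j k = ENNReal.ofReal β := by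
  apply le_antisymm
  · refine iSup₂_le fun d ⟨l, hl⟩ => ?_
    by_contra hlt
    rw [not_le, ENNReal.ofReal_lt_coe_iff hβ] at hlt
    refine not_tendsto_nhds_of_tendsto_atTop ?_ l hl
    have h1 : Tendsto (fun n : ℕ => (n : ℝ) ^ ((d : ℝ) - β) * ε) atTop atTop :=
      ((tendsto_rpow_atTop (sub_pos.2 hlt)).comp tendsto_natCast_atTop_atTop).atTop_mul_const hε
    refine tendsto_atTop_mono' _ ?_ h1
    filter_upwards [hlow, eventually_gt_atTop 0] with n hn hn0
    rw [scaled_eq_rpow_mul j k d β hn0]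
    gcongr
  · refine le_of_forall_lt fun x hx => ?_
    obtain ⟨d, hxd, hd⟩ := ENNReal.lt_iff_exists_nnreal_btwn.1 hx
    refine hxd.trans_le (le_iSup₂_of_le d ⟨0, ?_⟩ le_rfl)
    have hdβ : (d : ℝ) < β := by
      rw [← ENNReal.ofReal_coe_nnreal] at hd
      exact (ENNReal.ofReal_lt_ofReal_iff_of_nonneg d.2).1 hd
    have h1 : Tendsto (fun n : ℕ => (n : ℝ) ^ (-(β - d)) * B) atTop (𝓝 0) := by
      simpa using ((tendsto_rpow_neg_atTop (sub_pos.2 hdβ)).comp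
        tendsto_natCast_atTop_atTop).mul_const B
    refine squeeze_zero' ?_ ?_ h1
    · filter_upwards [hlow, eventually_gt_atTop 0] with n hn hn0
      rw [scaled_eq_rpow_mul j k d β hn0]
      have := hε.le.trans hn
      positivity
    · filter_upwards [hB, eventually_gt_atTop 0] with n hn hn0
      rw [scaled_eq_rpow_mul j k d β hn0, neg_sub]
      gcongr

lemma hasL_of_tendsto (j k : ℕ → ℤ) {β l : ℝ} (hβ : 0 ≤ β) (hl : 0 < l)
    (h : Tendsto (scaled j k β) atTop (𝓝 l)) : HasL j k l := by
  have hF := F_eq j k hβ (half_pos hl) (h.eventually_le_const (lt_add_one l))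
    (h.eventually_const_le (half_lt_self hl))
  refine ⟨by rw [hF]; exact ENNReal.ofReal_ne_top, ?_⟩
  rwa [hF, ENNReal.toReal_ofReal hβ]

lemma scaled_eq_profile_mul (j k : ℕ → ℤ) (d : ℝ) {n : ℕ} (hn : 0 < n) :
    scaled j k (3 / 2 - d) n =
      (n : ℝ) ^ (3 / 2 : ℝ) * P n (j n) (k n) /
        (catalan n * (|(n : ℝ) + 1 - j n - k n| + 1) ^ 2) *
          ((|(n : ℝ) + 1 - j n - k n| + 1) ^ 2 / (n : ℝ) ^ d) := by
  have hn' : (0 : ℝ) < n := by exact_mod_cast hn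
  rw [scaled, Real.rpow_sub hn']
  have : 0 < |(n : ℝ) + 1 - j n - k n| + 1 := by positivity
  have : 0 < (n : ℝ) ^ d := by positivity
  field_simp

lemma xi_half (a x : ℝ) : xi a (x / 2) = profile a 0 * (x + 1) ^ 2 := by
  rw [xi, profile]
  simp
  ring

lemma eta_eq (a c : ℝ) : eta a c = profile a 0 * (2 * c) ^ 2 := by
  rw [eta, profile]
  simp
  ring

lemma eta_mul_kappa (a c : ℝ) :
    eta a c * kappa a c = profile a ((2 * c) ^ 2) * (2 * c) ^ 2 := by
  have : -(2 * c) ^ 2 / (4 * (a * (1 - a))) = -c ^ 2 / (a * (1 - a)) := by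
    rw [show -(2 * c) ^ 2 = 4 * -c ^ 2 by ring, mul_div_mul_left _ _ (by norm_num)]
  rw [eta, kappa, profile, this]
  ring

/-! ### Roundings and their distance to the anti-diagonal -/

section Rounding

variable {a c α : ℝ} {j k : ℕ → ℤ}

lemma tendsto_rpow_div_nat (hα : α < 1) :
    Tendsto (fun n : ℕ => (n : ℝ) ^ α / n) atTop (𝓝 0) := by
  refine ((tendsto_rpow_neg_atTop (sub_pos.2 hα)).comp tendsto_natCast_atTop_atTop).congr' ?_
  filter_upwards [eventually_gt_atTop 0] with n hn
  have hn' : (0 : ℝ) < n := by exact_mod_cast hn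
  rw [Function.comp, neg_sub, Real.rpow_sub hn', Real.rpow_one]

lemma tendsto_div_of_abs_sub_le (hα : α < 1) {b d K : ℝ} {u : ℕ → ℝ}
    (hu : ∀ n : ℕ, |u n - (b * n - c * (n : ℝ) ^ α + d)| ≤ K) :
    Tendsto (fun n : ℕ => u n / n) atTop (𝓝 b) := by
  have h0 : Tendsto (fun n : ℕ => (u n - (b * n - c * (n : ℝ) ^ α + d)) / n) atTop (𝓝 0) := by
    refine squeeze_zero_norm (fun n => ?_) (tendsto_const_div_atTop_nhds_zero_nat K)
    rw [norm_div, Real.norm_eq_abs, Real.norm_of_nonneg (Nat.cast_nonneg n)]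
    gcongr
    exact hu n
  have h1 := ((h0.sub ((tendsto_rpow_div_nat hα).const_mul c)).add
    (tendsto_const_div_atTop_nhds_zero_nat d)).add_const b
  simp only [mul_zero, sub_zero, zero_add] at h1
  refine h1.congr' ?_
  filter_upwards [eventually_gt_atTop 0] with n hn
  have hn' : (0 : ℝ) < n := by exact_mod_cast hn
  field_simp
  ring

lemma IsRounding.tendsto_left (h : IsRounding a (1 - a) c α j k) (hα : α < 1) :
    Tendsto (fun n : ℕ => (j n : ℝ) / n) atTop (𝓝 a) := by
  obtain ⟨K, hK⟩ := h
  exact tendsto_div_of_abs_sub_le hα fun n => (hK n).1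

lemma IsRounding.tendsto_right (h : IsRounding a (1 - a) c α j k) (hα : α < 1) :
    Tendsto (fun n : ℕ => (k n : ℝ) / n) atTop (𝓝 (1 - a)) := by
  obtain ⟨K, hK⟩ := h
  refine tendsto_div_of_abs_sub_le (c := c) (d := 0) (K := K) hα fun n => ?_
  rw [add_zero]
  exact (hK n).2

lemma IsRounding.abs_sub_le (h : IsRounding a (1 - a) c α j k) :
    ∃ K : ℝ, ∀ n : ℕ, |(n : ℝ) + 1 - j n - k n - 2 * c * (n : ℝ) ^ α| ≤ K := by
  obtain ⟨K, hK⟩ := h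
  refine ⟨K + K + 1, fun n => ?_⟩
  obtain ⟨h1, h2⟩ := hK n
  rw [firstIndex] at h1
  rw [secondIndex] at h2
  rw [abs_le] at h1 h2 ⊢
  split_ifs at h1 <;> constructor <;> linarith

lemma rpow_mul_bounded (h : c = 0 ∨ α = 0) (n : ℕ) : c * (n : ℝ) ^ α = c := by
  rcases h with rfl | rfl <;> simp

lemma IsRounding.bounded (h : IsRounding a (1 - a) c α j k) (hc : c = 0 ∨ α = 0) :
    ∃ K : ℝ, ∀ n : ℕ, |(n : ℝ) + 1 - j n - k n| ≤ K := by
  obtain ⟨K, hK⟩ := h.abs_sub_le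
  refine ⟨K + |2 * c|, fun n => ?_⟩
  have := hK n
  rw [mul_assoc, rpow_mul_bounded hc] at this
  calc |(n : ℝ) + 1 - j n - k n| = |((n : ℝ) + 1 - j n - k n - 2 * c) + 2 * c| := by ring_nf
    _ ≤ _ := (abs_add_le _ _).trans (by gcongr)

lemma tendsto_sq_div_of_bounded {u : ℕ → ℝ} {K : ℝ} (hK : ∀ n, |u n| ≤ K) :
    Tendsto (fun n : ℕ => u n ^ 2 / n) atTop (𝓝 0) := by
  refine squeeze_zero (fun n => by positivity) (fun n => ?_)
    (tendsto_const_div_atTop_nhds_zero_nat (K ^ 2))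
  rw [← sq_abs]
  gcongr
  exact hK n

lemma IsRounding.F_eq_and_tendsto (h : IsRounding a (1 - a) c α j k) (ha₀ : 0 < a) (ha₁ : a < 1)
    (hα : α < 1) (hc : c = 0 ∨ α = 0) :
    F j k = ENNReal.ofReal (3 / 2) ∧
      Tendsto (fun n : ℕ => scaled j k (3 / 2) n - xi a (|(n : ℝ) + 1 - j n - k n| / 2))
        atTop (𝓝 0) := by
  obtain ⟨K, hK⟩ := h.bounded hc
  have hT := tendsto_profile ha₀ ha₁ j k (h.tendsto_left hα) (h.tendsto_right hα)
    (tendsto_sq_div_of_bounded hK)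
  have hpos := profile_pos ha₀ ha₁ 0
  have hK2 : ∀ n : ℕ, (|(n : ℝ) + 1 - j n - k n| + 1) ^ 2 ≤ (K + 1) ^ 2 := fun n => by
    gcongr
    exact hK n
  -- The `+ 1` keeps this factor away from `0` even on the anti-diagonal, which gives the lower
  -- bound required by `F_eq`.
  have hone : ∀ n : ℕ, 1 ≤ (|(n : ℝ) + 1 - j n - k n| + 1) ^ 2 := fun n =>
    one_le_pow₀ (by linarith [abs_nonneg ((n : ℝ) + 1 - j n - k n)])
  have hscaled : ∀ n : ℕ, 0 < n → scaled j k (3 / 2) n =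
      (n : ℝ) ^ (3 / 2 : ℝ) * P n (j n) (k n) /
        (catalan n * (|(n : ℝ) + 1 - j n - k n| + 1) ^ 2) *
          (|(n : ℝ) + 1 - j n - k n| + 1) ^ 2 := fun n hn => by
    simpa using scaled_eq_profile_mul j k 0 hn
  constructor
  · refine F_eq j k (B := (profile a 0 + 1) * (K + 1) ^ 2) (ε := profile a 0 / 2)
      (by norm_num) (half_pos hpos) ?_ ?_
    · filter_upwards [hT.eventually_le_const (lt_add_one _), eventually_gt_atTop 0] with n hn hn0
      rw [hscaled n hn0]
      exact mul_le_mul hn (hK2 n) (by positivity) (by positivity)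
    · filter_upwards [hT.eventually_const_le (half_lt_self hpos), eventually_gt_atTop 0]
        with n hn hn0
      rw [hscaled n hn0]
      exact hn.trans (le_mul_of_one_le_right ((half_pos hpos).le.trans hn) (hone n))
  -- The factor `(|δ| + 1)²` may oscillate, but it is bounded, so it multiplies an error tending to
  -- `0`.
  · have h0 := (hT.sub_const (profile a 0)).abs.mul_const ((K + 1) ^ 2)
    rw [sub_self, abs_zero, zero_mul] at h0
    refine squeeze_zero_norm' ?_ h0
    filter_upwards [eventually_gt_atTop 0] with n hn0
    rw [hscaled n hn0, xi_half, ← sub_mul, norm_mul, Real.norm_eq_abs,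
      Real.norm_of_nonneg (by positivity)]
    gcongr
    exact hK n

lemma IsRounding.tendsto_sub_div_rpow (h : IsRounding a (1 - a) c α j k) (hα : 0 < α) :
    Tendsto (fun n : ℕ => ((n : ℝ) + 1 - j n - k n) / (n : ℝ) ^ α) atTop (𝓝 (2 * c)) := by
  obtain ⟨K, hK⟩ := h.abs_sub_le
  have hinv : Tendsto (fun n : ℕ => K / (n : ℝ) ^ α) atTop (𝓝 0) :=
    ((tendsto_rpow_atTop hα).comp tendsto_natCast_atTop_atTop).const_div_atTop K
  have h0 : Tendsto (fun n : ℕ =>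
      ((n : ℝ) + 1 - j n - k n - 2 * c * (n : ℝ) ^ α) / (n : ℝ) ^ α) atTop (𝓝 0) := by
    refine squeeze_zero_norm (fun n => ?_) hinv
    rw [norm_div, Real.norm_eq_abs, Real.norm_of_nonneg (show (0 : ℝ) ≤ (n : ℝ) ^ α by positivity)]
    gcongr
    exact hK n
  have h1 := h0.add_const (2 * c)
  rw [zero_add] at h1
  refine h1.congr' ?_
  filter_upwards [eventually_gt_atTop 0] with n hn
  have hn' : (0 : ℝ) < n := by exact_mod_cast hn
  have : (0 : ℝ) < (n : ℝ) ^ α := by positivity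
  field_simp
  ring

/-- Since `(|δ| + 1)² / n^(2α) → (2c)²`, the limit is positive exactly at the exponent `3/2 - 2α`.
-/
lemma IsRounding.hasL (h : IsRounding a (1 - a) c α j k) (ha₀ : 0 < a) (ha₁ : a < 1)
    (hc : c ≠ 0) (hα₀ : 0 < α) (hα₁ : α ≤ 1 / 2) {μ : ℝ}
    (hμ : Tendsto (fun n : ℕ => ((n : ℝ) + 1 - j n - k n) ^ 2 / n) atTop (𝓝 μ)) :
    HasL j k (profile a μ * (2 * c) ^ 2) := by
  have hT := tendsto_profile ha₀ ha₁ j k (h.tendsto_left (by linarith))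
    (h.tendsto_right (by linarith)) hμ
  refine hasL_of_tendsto j k (β := 3 / 2 - 2 * α) (by linarith)
    (mul_pos (profile_pos ha₀ ha₁ μ) (by positivity)) ?_
  -- After division by `n^α` the `+ 1` in `|δ| + 1` disappears; hence `4c²` here instead of the `(2c
  -- + 1)²` of the bounded case.
  have hinv : Tendsto (fun n : ℕ => ((n : ℝ) ^ α)⁻¹) atTop (𝓝 0) :=
    ((tendsto_rpow_atTop hα₀).comp tendsto_natCast_atTop_atTop).inv_tendsto_atTop
  have hsq := ((h.tendsto_sub_div_rpow hα₀).abs.add hinv).pow 2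
  rw [add_zero, sq_abs] at hsq
  refine (hT.mul hsq).congr' ?_
  filter_upwards [eventually_gt_atTop 0] with n hn
  have hn' : (0 : ℝ) < n := by exact_mod_cast hn
  have : (0 : ℝ) < (n : ℝ) ^ α := by positivity
  rw [scaled_eq_profile_mul j k (2 * α) hn, abs_div, abs_of_pos this, inv_eq_one_div, ← add_div,
    div_pow, mul_comm 2 α, Real.rpow_mul hn'.le, Real.rpow_two]

lemma IsRounding.tendsto_sq_div (h : IsRounding a (1 - a) c α j k) (hα₀ : 0 < α)
    (hα₁ : α < 1 / 2) :
    Tendsto (fun n : ℕ => ((n : ℝ) + 1 - j n - k n) ^ 2 / n) atTop (𝓝 0) := by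
  have h1 := ((h.tendsto_sub_div_rpow hα₀).pow 2).mul
    (tendsto_rpow_div_nat (show α * 2 < 1 by linarith))
  rw [mul_zero] at h1
  refine h1.congr' ?_
  filter_upwards [eventually_gt_atTop 0] with n hn
  have hn' : (0 : ℝ) < n := by exact_mod_cast hn
  have : (0 : ℝ) < (n : ℝ) ^ α := by positivity
  rw [div_pow, Real.rpow_mul hn'.le, Real.rpow_two]
  field_simp

lemma IsRounding.tendsto_sq_div_half (h : IsRounding a (1 - a) c (1 / 2) j k) :
    Tendsto (fun n : ℕ => ((n : ℝ) + 1 - j n - k n) ^ 2 / n) atTop (𝓝 ((2 * c) ^ 2)) := by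
  refine ((h.tendsto_sub_div_rpow (by norm_num)).pow 2).congr fun n => ?_
  rw [div_pow, ← Real.sqrt_eq_rpow, Real.sq_sqrt (Nat.cast_nonneg n)]

lemma KeepsDistance.eventually_eq (h : KeepsDistance a (1 - a) c α j k) (hc : c = 0 ∨ α = 0) :
    ∀ᶠ n : ℕ in atTop, |(n : ℝ) + 1 - j n - k n| / 2 = |c| := by
  filter_upwards [h] with n hn
  rw [firstIndex, secondIndex, rpow_mul_bounded hc, if_pos ⟨by ring, hc.symm⟩] at hn
  rw [show (n : ℝ) + 1 - j n - k n = 2 * c by linarith, abs_mul, abs_two]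
  ring

end Rounding

end PatternShape

theorem theoremT2 (a c α : ℝ) (ha₀ : 0 < a) (ha₁ : a < 1) (hα₀ : 0 ≤ α) (hα₁ : α ≤ 1 / 2)
    (j k : ℕ → ℤ) (hjk : PatternShape.IsRounding a (1 - a) c α j k) :
    ((c = 0 ∨ α = 0) → PatternShape.KeepsDistance a (1 - a) c α j k →
      PatternShape.HasL j k (PatternShape.xi a |c|)) ∧
    ((c = 0 ∨ α = 0) → PatternShape.F j k ≠ ⊤ ∧
      Tendsto (fun n : ℕ => PatternShape.scaled j k (PatternShape.F j k).toReal n -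
        PatternShape.xi a (|(n : ℝ) + 1 - j n - k n| / 2)) atTop (𝓝 0)) ∧
    (c ≠ 0 → 0 < α → α < 1 / 2 →
      PatternShape.HasL j k (PatternShape.eta a c)) ∧
    (c ≠ 0 → α = 1 / 2 →
      PatternShape.HasL j k (PatternShape.eta a c * PatternShape.kappa a c)) := by
  have bounded_case : (c = 0 ∨ α = 0) → PatternShape.F j k ≠ ⊤ ∧
      Tendsto (fun n : ℕ => PatternShape.scaled j k (PatternShape.F j k).toReal n -
        PatternShape.xi a (|(n : ℝ) + 1 - j n - k n| / 2)) atTop (𝓝 0) := fun hc => by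
    obtain ⟨hF, h⟩ := hjk.F_eq_and_tendsto ha₀ ha₁ (by linarith) hc
    rw [hF, ENNReal.toReal_ofReal (by norm_num)]
    exact ⟨ENNReal.ofReal_ne_top, h⟩
  refine ⟨fun hc hd => ?_, bounded_case, fun hc h0 h1 => ?_, fun hc h1 => ?_⟩
  · obtain ⟨hF, h⟩ := bounded_case hc
    refine ⟨hF, ?_⟩
    have h' := h.add_const (PatternShape.xi a |c|)
    rw [zero_add] at h'
    refine h'.congr' ?_
    filter_upwards [hd.eventually_eq hc] with n hn
    rw [hn, sub_add_cancel]
  · rw [PatternShape.eta_eq]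
    exact hjk.hasL ha₀ ha₁ hc h0 hα₁ (hjk.tendsto_sq_div h0 h1)
  · subst h1
    rw [PatternShape.eta_mul_kappa]
    exact hjk.hasL ha₀ ha₁ hc (by norm_num) le_rfl hjk.tendsto_sq_div_half
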